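/- For integers $n,k\ge 0$ and $q\ge 1$ let $\binom{n,q}{k}$ denote the coefficient of $x^k$ in $(1+x+\cdots+x^{q-1})^n$. Let $q>3$ be an integer. Then the equation $$(q-2)x^{q+1}-(q-1)x^q+2x-1=0$$ has exactly two distinct positive real roots, namely $1$ and a root $r=r(q)\neq 1$. This $r$ satisfies $$\left|r-\frac12-\frac{q}{2^{q+2}}\right|\le\frac{q^3}{2^{2q}},$$ and, with $q$ fixed and $n\to\infty$, $$\binom{n,q}{n}\sim\frac{\phi(r)}{\sqrt{2\pi n}}\left(\frac{1-r^q}{r-r^2}\right)^n,\qquad \phi(r)=\left(\frac{r}{(1-r)^2}-\frac{q^2r^q}{(1-r^q)^2}\right)^{-1/2},$$ where $f(n)\sim g(n)$ means $\lim_{n\to\infty}f(n)/g(n)=1$. -/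

import Mathlib

open Filter Topology

/-- The polynomial coefficient `(n,q choose k)`: the coefficient of `x ^ k` in
`(1 + x + ⋯ + x ^ (q - 1)) ^ n`. -/
noncomputable def polyCoeff (n q k : ℕ) : ℕ :=
  ((∑ i ∈ Finset.range q, (Polynomial.X : Polynomial ℕ) ^ i) ^ n).coeff k

/-- `φ(r) = (r / (1 - r)² - q² r^q / (1 - r^q)²) ^ (-1/2)`. -/
noncomputable def phi (q : ℕ) (r : ℝ) : ℝ :=
  (r / (1 - r) ^ 2 - (q : ℝ) ^ 2 * r ^ q / (1 - r ^ q) ^ 2) ^ (-(1 / 2) : ℝ)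

/-! Removing the double root at 1 from the equation leaves `∑ j < q-1, j * x^(j+1) = 1`. The left
side increases strictly on `x ≥ 0`, is below 1 at 1/2 and above 1 at 1, so there is one further
positive root r, in (1/2, 1) (`saddle_factor`, `exists_saddle`). For the asymptotics, give k < q the
weight `r^k / f` with `f = ∑ r^k`. The equation for r says exactly that this law has mean 1. The
probability that n independent copies sum to n is `polyCoeff n q n * r^n / f^n`, and the local limit
theorem `tendsto_sqrt_mul_coeff_pow` makes it asymptotic to `1 / √(2πnV)`. Here V is the variance,
equal to `phi q r ^ (-2)` by `variance_eq`, and f / r is the exponential base of the theorem. -/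

open MeasureTheory

/-! ### The saddle point -/

/-- The factorization behind the saddle point equation. -/
lemma saddle_factor (m : ℕ) (x : ℝ) :
    ((m : ℝ) - 1) * x ^ (m + 2) - (m : ℝ) * x ^ (m + 1) + 2 * x - 1 =
      (1 - x) ^ 2 * (∑ j ∈ Finset.range m, (j : ℝ) * x ^ (j + 1) - 1) := by
  induction m with
  | zero => simp; ring
  | succ m ih =>
    rw [Finset.sum_range_succ]
    push_cast
    linear_combination ih

lemma strictMonoOn_sum_mul_pow {m : ℕ} (hm : 3 ≤ m) :
    StrictMonoOn (fun x : ℝ => ∑ j ∈ Finset.range m, (j : ℝ) * x ^ (j + 1)) (Set.Ici 0) := by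
  intro x hx y _ hxy
  have hx : 0 ≤ x := hx
  refine Finset.sum_lt_sum (fun j _ => ?_) ⟨1, Finset.mem_range.2 (by omega), ?_⟩
  · gcongr
  · simp only [Nat.cast_one, one_mul]
    gcongr

/-- The factorization at 1/2 evaluates the sum as `1 - (m+1) / 2^m`. -/
lemma sum_mul_half_pow_lt_one (m : ℕ) :
    ∑ j ∈ Finset.range m, (j : ℝ) * (1 / 2) ^ (j + 1) < 1 := by
  have h := saddle_factor m (1 / 2)
  have : (0 : ℝ) < (1 / 2) ^ m := by positivity
  have hm : (0 : ℝ) ≤ m := by positivity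
  rw [pow_add, pow_add] at h
  nlinarith

/-- Existence and uniqueness of the saddle point, in terms of the factored equation. -/
lemma exists_saddle {m : ℕ} (hm : 3 ≤ m) :
    ∃ r : ℝ, 1 / 2 < r ∧ r < 1 ∧ ∑ j ∈ Finset.range m, (j : ℝ) * r ^ (j + 1) = 1 := by
  set S : ℝ → ℝ := fun x => ∑ j ∈ Finset.range m, (j : ℝ) * x ^ (j + 1) with hS
  have h1 : 1 < S 1 := by
    have : ∑ j ∈ Finset.range 3, (j : ℝ) * (1 : ℝ) ^ (j + 1) ≤ S 1 :=
      Finset.sum_le_sum_of_subset_of_nonneg (Finset.range_mono hm) (fun _ _ _ => by positivity)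
    norm_num [Finset.sum_range_succ] at this
    linarith
  have hcont : ContinuousOn S (Set.Icc (1 / 2) 1) := by
    simp only [hS]
    fun_prop
  obtain ⟨r, hr, hr1⟩ := intermediate_value_Ioo (by norm_num) hcont
    (show (1 : ℝ) ∈ Set.Ioo (S (1 / 2)) (S 1) from ⟨sum_mul_half_pow_lt_one m, h1⟩)
  exact ⟨r, hr.1, hr.2, hr1⟩

lemma saddle_eq_zero_iff {m : ℕ} (hm : 3 ≤ m) {r : ℝ} (hr : 0 < r)
    (h : ∑ j ∈ Finset.range m, (j : ℝ) * r ^ (j + 1) = 1) {x : ℝ} (hx : 0 < x) :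
    ((m : ℝ) - 1) * x ^ (m + 2) - (m : ℝ) * x ^ (m + 1) + 2 * x - 1 = 0 ↔ x = 1 ∨ x = r := by
  rw [saddle_factor, mul_eq_zero, sub_eq_zero, ← h,
    (strictMonoOn_sum_mul_pow hm).injOn.eq_iff (x := x) (y := r) hx.le hr.le, h,
    pow_eq_zero_iff two_ne_zero, sub_eq_zero, eq_comm (a := (1 : ℝ))]

lemma saddle_le {m : ℕ} (hm : 3 ≤ m) {r : ℝ} (hr : 0 < r)
    (h : ∑ j ∈ Finset.range m, (j : ℝ) * r ^ (j + 1) = 1) {x : ℝ} (hx : 0 < x)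
    (hP : 0 ≤ ((m : ℝ) - 1) * x ^ (m + 2) - (m : ℝ) * x ^ (m + 1) + 2 * x - 1) (hx1 : x ≠ 1) :
    r ≤ x := by
  rw [saddle_factor, mul_nonneg_iff_of_pos_left (by
    have : 1 - x ≠ 0 := sub_ne_zero.2 hx1.symm
    positivity), sub_nonneg, ← h] at hP
  exact ((strictMonoOn_sum_mul_pow hm).le_iff_le (a := r) (b := x) hr.le hx.le).1 hP

/-! ### Numerical estimate of the root -/

/-- Equality at q = 6 fixes the constant 9/16. -/
lemma sq_le_two_pow_mul {q : ℕ} (hq : 6 ≤ q) : 16 * (q : ℝ) ^ 2 ≤ 9 * 2 ^ q := by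
  induction q, hq using Nat.le_induction with
  | base => norm_num
  | succ n hn ih =>
    have : (6 : ℝ) ≤ n := by exact_mod_cast hn
    push_cast
    rw [pow_succ (2 : ℝ) n]
    nlinarith

/-- `(1 + 2 d) ^ q ≤ 1 + u + u ^ 2` and `u ≤ 9 / 16`, where `u = q ^ 2 / 2 ^ q` and
`2 d ≤ q / 2 ^ q`. -/
lemma one_add_mul_pow_le {q : ℕ} (hq : 6 ≤ q) {w d : ℝ} (hw : w = (1 / 2) ^ q) (hd0 : 0 ≤ d)
    (hd : d ≤ q * w / 2) :
    (1 + 2 * d) ^ q ≤ 1 + q ^ 2 * w + (q ^ 2 * w) ^ 2 ∧ q ^ 2 * w ≤ 9 / 16 := by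
  have hu : (q : ℝ) ^ 2 * w ≤ 9 / 16 := by
    have := sq_le_two_pow_mul hq
    rw [hw, one_div, inv_pow, ← div_eq_mul_inv, div_le_div_iff₀ (by positivity) (by norm_num)]
    linarith
  have hu0 : 0 ≤ (q : ℝ) ^ 2 * w := by rw [hw]; positivity
  refine ⟨?_, hu⟩
  calc (1 + 2 * d) ^ q ≤ Real.exp (q * w) ^ q := by
        gcongr
        linarith [Real.add_one_le_exp ((q : ℝ) * w)]
    _ = Real.exp (q ^ 2 * w) := by rw [← Real.exp_nat_mul]; ring_nf
    _ ≤ 1 + q ^ 2 * w + (q ^ 2 * w) ^ 2 := by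
        have := (abs_le.1 (Real.norm_exp_sub_one_sub_id_le (x := (q : ℝ) ^ 2 * w)
          (by rw [Real.norm_of_nonneg hu0]; linarith))).2
        rw [Real.norm_of_nonneg hu0] at this
        linarith

lemma abs_saddle_sub_le {q : ℕ} (hq : 3 < q) {r : ℝ} (hr : 1 / 2 < r) (hr1 : r < 1)
    (h : ∑ j ∈ Finset.range (q - 1), (j : ℝ) * r ^ (j + 1) = 1) :
    |r - 1 / 2 - (q : ℝ) / 2 ^ (q + 2)| ≤ (q : ℝ) ^ 3 / 2 ^ (2 * q) := by
  obtain ⟨m, rfl⟩ : ∃ m, q = m + 1 := ⟨q - 1, by omega⟩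
  rw [Nat.add_sub_cancel] at h
  have hm : 3 ≤ m := by omega
  have key := fun x => saddle_le hm (r := r) (by linarith) h (x := x)
  -- For q = 4, 5 the tolerances 1/4 and 125/1024 are so wide that r > 1/2 and one test point
  -- suffice.
  rcases (show m = 3 ∨ m = 4 ∨ 5 ≤ m by omega) with rfl | rfl | hm5
  · have := key (7 / 10) (by norm_num) (by norm_num) (by norm_num)
    rw [abs_le]
    constructor <;> norm_num <;> linarith
  · have := key (3 / 5) (by norm_num) (by norm_num) (by norm_num)
    rw [abs_le]
    constructor <;> norm_num <;> linarith
  · have hP := (saddle_eq_zero_iff hm (r := r) (by linarith) h (x := r) (by linarith)).2 (.inr rfl)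
    have hq6 : 6 ≤ m + 1 := by omega
    have hm' : (5 : ℝ) ≤ m := by exact_mod_cast hm5
    obtain ⟨w, hw⟩ : ∃ w : ℝ, w = (1 / 2) ^ (m + 1) := ⟨_, rfl⟩
    have hw0 : 0 < w := by rw [hw]; positivity
    have hpow : ∀ d : ℝ, (1 / 2 + d) ^ (m + 1) = w * (1 + 2 * d) ^ (m + 1) := by
      intro d
      rw [hw, ← mul_pow]
      ring_nf
    have h1 : ((m + 1 : ℕ) : ℝ) / 2 ^ (m + 1 + 2) = (m + 1) * w / 4 := by
      rw [hw, pow_add, one_div, inv_pow]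
      push_cast
      field_simp
      norm_num
    have h2 : ((m + 1 : ℕ) : ℝ) ^ 3 / 2 ^ (2 * (m + 1)) = (m + 1) ^ 3 * w ^ 2 := by
      rw [hw, mul_comm 2, pow_mul, one_div, inv_pow]
      push_cast
      field_simp
    -- a crude upper bound, bootstrapped below
    have hcrude : r ≤ 1 / 2 + (m + 1) * w / 2 := by
      -- The test point is 1/2 + d with d twice the expected qw/4. The polynomial there is `2d -
      -- wT(q/2 - (q-2)d)` with `T = (1+2d)^q`; it is nonnegative because T ≤ 2 and 2d = qw.
      obtain ⟨hb, hu⟩ := one_add_mul_pow_le hq6 hw (d := (m + 1) * w / 2) (by positivity)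
        (by push_cast; rfl)
      push_cast at hb hu
      have hu0 : 0 ≤ ((m : ℝ) + 1) ^ 2 * w := by positivity
      have hx1 : (m + 1) * w / 2 < 1 / 4 := by nlinarith
      refine key _ (by positivity) ?_ (by linarith)
      rw [pow_succ _ (m + 1), hpow]
      have hT : (1 + 2 * ((m + 1) * w / 2)) ^ (m + 1) ≤ 2 := hb.trans (by nlinarith)
      have hT0 : 0 ≤ (1 + 2 * ((m + 1) * w / 2)) ^ (m + 1) := by positivity
      generalize (1 + 2 * ((m + 1) * w / 2)) ^ (m + 1) = T at hT hT0 ⊢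
      have e1 : w * T * (m + 1) / 2 ≤ w * (m + 1) := by
        have : 0 ≤ w * (m + 1) := by positivity
        nlinarith
      have e2 : 0 ≤ ((m : ℝ) - 1) * (w * T) * ((m + 1) * w / 2) := by
        have : (0 : ℝ) ≤ m - 1 := by linarith
        positivity
      nlinarith
    obtain ⟨d, rfl⟩ : ∃ d, r = 1 / 2 + d := ⟨r - 1 / 2, by ring⟩
    have hd0 : 0 ≤ d := by linarith
    obtain ⟨hb, hu⟩ := one_add_mul_pow_le hq6 hw hd0 (by push_cast; linarith)
    push_cast at hb hu
    have hlow : 1 ≤ (1 + 2 * d) ^ (m + 1) := one_le_pow₀ (by linarith)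
    rw [pow_succ _ (m + 1), hpow] at hP
    generalize (1 + 2 * d) ^ (m + 1) = T at hP hb hlow
    -- Fixed-point form of the equation: T ≥ 1 and the crude bound on d give the lower estimate, an
    -- upper bound on T the other.
    have hP' : 2 * d = w * T * ((m + 1) / 2 - (m - 1) * d) := by linear_combination hP
    have hu0 : 0 ≤ ((m : ℝ) + 1) ^ 2 * w := by positivity
    rw [h1, h2, abs_le]
    constructor
    · have e1 : w * ((m + 1) / 2 - (m - 1) * d) ≤ 2 * d := by
        rw [hP']
        have : 0 ≤ ((m : ℝ) + 1) / 2 - (m - 1) * d := by nlinarith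
        have : 0 ≤ w * (((m : ℝ) + 1) / 2 - (m - 1) * d) := by positivity
        nlinarith
      have e2 : ((m : ℝ) - 1) * d * w ≤ (m - 1) * ((m + 1) * w / 2) * w := by
        have : (0 : ℝ) ≤ m - 1 := by linarith
        gcongr
        linarith
      have e3 : ((m : ℝ) - 1) * (m + 1) * w ^ 2 ≤ (m + 1) ^ 3 * w ^ 2 := by
        gcongr
        nlinarith
      have : 0 ≤ ((m : ℝ) + 1) ^ 3 * w ^ 2 := by positivity
      nlinarith
    · have e1 : 2 * d ≤ w * T * ((m + 1) / 2) := by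
        rw [hP']
        have : (0 : ℝ) ≤ m - 1 := by linarith
        gcongr
        nlinarith
      -- The slack 4 yields exactly the permitted error `q^3 * w^2`.
      have e2 : T ≤ 1 + 4 * ((m + 1) ^ 2 * w) := by nlinarith
      have : w * T * ((m + 1) / 2) ≤ w * (1 + 4 * ((m + 1) ^ 2 * w)) * ((m + 1) / 2) := by gcongr
      nlinarith

/-! ### Fourier inversion and the local limit theorem -/

lemma integral_exp_int_mul_I (k : ℤ) :
    ∫ t in (-Real.pi)..Real.pi, Complex.exp (k * t * Complex.I) =
      if k = 0 then 2 * (Real.pi : ℂ) else 0 := by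
  split_ifs with hk
  · subst hk
    simp
    ring
  · have hc : (k : ℂ) * Complex.I ≠ 0 := by simp [hk]
    have := integral_exp_mul_complex (a := -Real.pi) (b := Real.pi) hc
    simp_rw [show ∀ t : ℝ, (k : ℂ) * t * Complex.I = k * Complex.I * t from fun t => by ring]
    rw [this, div_eq_zero_iff, sub_eq_zero]
    left
    rw [Complex.exp_eq_exp_iff_exists_int]
    exact ⟨k, by push_cast; ring⟩

/-- Fourier inversion for the coefficients of a polynomial. -/
lemma Polynomial.integral_eval_exp_mul (P : Polynomial ℂ) (m : ℕ) :
    ∫ t in (-Real.pi)..Real.pi,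
      P.eval (Complex.exp (t * Complex.I)) * Complex.exp (-(m * t * Complex.I)) =
      2 * Real.pi * P.coeff m := by
  have h : ∀ t : ℝ, P.eval (Complex.exp (t * Complex.I)) * Complex.exp (-(m * t * Complex.I)) =
      ∑ k ∈ P.support, P.coeff k * Complex.exp (((k - m : ℤ) : ℂ) * t * Complex.I) := by
    intro t
    rw [Polynomial.eval_eq_sum, Polynomial.sum, Finset.sum_mul]
    refine Finset.sum_congr rfl fun k _ => ?_
    rw [← Complex.exp_nat_mul, mul_assoc, ← Complex.exp_add]
    congr 2
    push_cast
    ring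
  simp_rw [h]
  rw [intervalIntegral.integral_finsetSum fun k _ =>
    (Continuous.intervalIntegrable (by fun_prop) _ _)]
  simp_rw [intervalIntegral.integral_const_mul, integral_exp_int_mul_I, sub_eq_zero,
    Nat.cast_inj, mul_ite, mul_zero]
  rw [Finset.sum_ite_eq']
  split_ifs with hm
  · ring
  · rw [Polynomial.notMem_support_iff.1 hm, mul_zero]

/-- The characteristic function of `X - 1`, where `X` takes the value `k < q` with
probability `p k`. -/
noncomputable def centeredChar (p : ℕ → ℝ) (q : ℕ) (t : ℝ) : ℂ :=
  ∑ k ∈ Finset.range q, (p k : ℂ) * Complex.exp (((k : ℝ) - 1 : ℝ) * t * Complex.I)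

lemma continuous_centeredChar (p : ℕ → ℝ) (q : ℕ) : Continuous (centeredChar p q) := by
  unfold centeredChar
  fun_prop

lemma integral_centeredChar_pow (p : ℕ → ℝ) (q n : ℕ) :
    ∫ t in (-Real.pi)..Real.pi, centeredChar p q t ^ n =
      2 * Real.pi * (((∑ k ∈ Finset.range q, Polynomial.C (p k) * Polynomial.X ^ k) ^ n).coeff n
        : ℝ) := by
  have := Polynomial.integral_eval_exp_mul
    (((∑ k ∈ Finset.range q, Polynomial.C (p k) * Polynomial.X ^ k) ^ n).map Complex.ofRealHom) n
  rw [Polynomial.coeff_map] at this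
  rw [Complex.ofRealHom_eq_coe] at this
  rw [← this]
  congr 1
  ext t
  simp only [Polynomial.map_pow, Polynomial.map_sum, Polynomial.map_mul, Polynomial.map_C,
    Polynomial.map_X, Polynomial.eval_pow, Polynomial.eval_finsetSum, Polynomial.eval_mul,
    Polynomial.eval_C, Polynomial.eval_X, Complex.ofRealHom_eq_coe]
  rw [show -((n : ℂ) * t * Complex.I) = n * (-(t * Complex.I)) by ring, Complex.exp_nat_mul,
    ← mul_pow, Finset.sum_mul, centeredChar]
  congr 1
  refine Finset.sum_congr rfl fun k _ => ?_
  rw [← Complex.exp_nat_mul, mul_assoc (p k : ℂ), ← Complex.exp_add]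
  congr 2
  push_cast
  ring

/-- The squared norm is `(a+b)^2 - 2ab(1 - cos t)`; adding `(ab/(a+b) * (1 - cos t))^2` completes
the square. -/
lemma norm_add_mul_exp_le {a b : ℝ} (ha : 0 < a) (hb : 0 < b) (t : ℝ) :
    ‖(b : ℂ) + a * Complex.exp (-t * Complex.I)‖ ≤
      a + b - a * b / (a + b) * (1 - Real.cos t) := by
  have hc1 := Real.cos_le_one t
  have hc2 := Real.neg_one_le_cos t
  have hab : 0 < a + b := by linarith
  have hc : a * b / (a + b) * (a + b) = a * b := by field_simp
  have hcpos : 0 < a * b / (a + b) := by positivity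
  have hle : 0 ≤ a + b - a * b / (a + b) * (1 - Real.cos t) := by
    have : a * b / (a + b) * 2 ≤ a + b := by
      rw [div_mul_eq_mul_div, div_le_iff₀ hab]
      nlinarith [sq_nonneg (a - b)]
    nlinarith
  rw [← abs_of_nonneg hle, ← abs_of_nonneg (norm_nonneg _)]
  refine sq_le_sq.1 ?_
  rw [← Complex.normSq_eq_norm_sq, Complex.normSq_apply]
  have : Complex.exp (-t * Complex.I) = (Real.cos t : ℂ) - Real.sin t * Complex.I := by
    rw [Complex.exp_mul_I]
    simp
    ring
  rw [this]
  simp only [Complex.add_re, Complex.add_im, Complex.mul_re, Complex.mul_im, Complex.sub_re,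
    Complex.sub_im, Complex.ofReal_re, Complex.ofReal_im, Complex.I_re, Complex.I_im]
  generalize a * b / (a + b) = c at hc hcpos hle
  rw [← sub_nonneg]
  refine (sq_nonneg (c * (1 - Real.cos t))).trans_eq ?_
  linear_combination 2 * (1 - Real.cos t) * hc + a ^ 2 * Real.sin_sq_add_cos_sq t

/-- Mass at the adjacent points 0 and 1 already forces decay on all of [-π, π]. After rescaling this
is the dominating Gaussian. -/
lemma exists_norm_centeredChar_le {p : ℕ → ℝ} {q : ℕ} (hq : 2 ≤ q) (hp : ∀ k, 0 ≤ p k)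
    (h0 : 0 < p 0) (h1 : 0 < p 1) (hsum : ∑ k ∈ Finset.range q, p k = 1) :
    ∃ c > 0, ∀ t : ℝ, |t| ≤ Real.pi → ‖centeredChar p q t‖ ≤ Real.exp (-c * t ^ 2) := by
  obtain ⟨m, rfl⟩ : ∃ m, q = m + 2 := ⟨q - 2, by omega⟩
  have hpi := Real.pi_pos
  refine ⟨p 0 * p 1 / (p 0 + p 1) * (2 / Real.pi ^ 2), by positivity, fun t ht => ?_⟩
  have hcos := Real.cos_le_one_sub_mul_cos_sq ht
  rw [Finset.sum_range_succ', Finset.sum_range_succ'] at hsum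
  rw [centeredChar, Finset.sum_range_succ', Finset.sum_range_succ', add_assoc]
  have hrest : ‖∑ k ∈ Finset.range m, (p (k + 1 + 1) : ℂ) *
      Complex.exp ((((k + 1 + 1 : ℕ) : ℝ) - 1 : ℝ) * t * Complex.I)‖ ≤
      ∑ k ∈ Finset.range m, p (k + 1 + 1) := by
    refine (norm_sum_le _ _).trans (Finset.sum_le_sum fun k _ => ?_)
    rw [norm_mul, ← Complex.ofReal_mul, Complex.norm_exp_ofReal_mul_I, Complex.norm_real,
      Real.norm_of_nonneg (hp _), mul_one]
  have hmain := norm_add_mul_exp_le h0 h1 t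
  refine (norm_add_le _ _).trans ?_
  have e : (p (0 + 1) : ℂ) * Complex.exp ((((0 + 1 : ℕ) : ℝ) - 1 : ℝ) * t * Complex.I) +
      p 0 * Complex.exp ((((0 : ℕ) : ℝ) - 1 : ℝ) * t * Complex.I) =
      (p 1 : ℂ) + p 0 * Complex.exp (-t * Complex.I) := by simp
  rw [e]
  have hcpos : 0 < p 0 * p 1 / (p 0 + p 1) := by positivity
  have hexp := Real.add_one_le_exp (-(p 0 * p 1 / (p 0 + p 1) * (2 / Real.pi ^ 2)) * t ^ 2)
  simp only [zero_add] at hsum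
  have : p 0 * p 1 / (p 0 + p 1) * (2 / Real.pi ^ 2 * t ^ 2) ≤
      p 0 * p 1 / (p 0 + p 1) * (1 - Real.cos t) := by gcongr; linarith
  nlinarith

/-- Second-order Taylor expansion at `x = a / √n`: n times the cubic remainder is at most `a^2 *
|x|`, up to a constant. -/
lemma tendsto_nat_mul_exp_sub (a : ℝ) :
    Tendsto (fun n : ℕ => (n : ℂ) * (Complex.exp ((a / √n : ℝ) * Complex.I) - 1 -
      (a / √n : ℝ) * Complex.I)) atTop (𝓝 (-a ^ 2 / 2 : ℝ)) := by
  have hs : Tendsto (fun n : ℕ => a / √(n : ℝ)) atTop (𝓝 0) :=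
    tendsto_const_nhds.div_atTop (Real.tendsto_sqrt_atTop.comp tendsto_natCast_atTop_atTop)
  rw [tendsto_iff_norm_sub_tendsto_zero]
  have hlim : Tendsto (fun n : ℕ => a ^ 2 * |a / √(n : ℝ)|) atTop (𝓝 0) := by
    simpa using hs.abs.const_mul (a ^ 2)
  refine squeeze_zero' (.of_forall fun _ => norm_nonneg _) ?_ hlim
  have hs1 : ∀ᶠ n : ℕ in atTop, |a / √(n : ℝ)| ≤ 1 := by
    have := hs.abs
    rw [abs_zero] at this
    exact this.eventually_le_const (by norm_num)
  filter_upwards [hs1, eventually_gt_atTop 0] with n hn hn0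
  have hn0' : (0 : ℝ) < n := by exact_mod_cast hn0
  set x : ℝ := a / √(n : ℝ) with hx
  have hx2 : (n : ℝ) * x ^ 2 = a ^ 2 := by
    rw [hx, div_pow, Real.sq_sqrt hn0'.le]
    field_simp
  have hb := Complex.exp_bound (x := x * Complex.I) (by simpa using hn) (n := 3) (by norm_num)
  have heq : (n : ℂ) * (Complex.exp (x * Complex.I) - 1 - x * Complex.I) - (-a ^ 2 / 2 : ℝ) =
      n * (Complex.exp (x * Complex.I) -
        ∑ m ∈ Finset.range 3, (x * Complex.I) ^ m / m.factorial) := by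
    rw [← hx2]
    simp [Finset.sum_range_succ, Nat.factorial, mul_pow]
    ring
  rw [heq, norm_mul, Complex.norm_natCast]
  refine (mul_le_mul_of_nonneg_left hb hn0'.le).trans ?_
  rw [norm_mul, Complex.norm_I, mul_one, Complex.norm_real, Real.norm_eq_abs, ← hx2, ← sq_abs x]
  norm_num [Nat.factorial]
  have : 0 ≤ (n : ℝ) * |x| ^ 3 := by positivity
  have hx3 : |x| ^ 3 = x ^ 2 * |x| := by rw [pow_succ, sq_abs]
  rw [hx3] at this ⊢
  linarith

/-- Mean zero cancels the first-order term, so the base is `1 - V s^2 / (2n) + o(1/n)`. -/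
lemma tendsto_centeredChar_pow {p : ℕ → ℝ} {q : ℕ} (hsum : ∑ k ∈ Finset.range q, p k = 1)
    (hmean : ∑ k ∈ Finset.range q, p k * ((k : ℝ) - 1) = 0) (s : ℝ) :
    Tendsto (fun n : ℕ => centeredChar p q (s / √n) ^ n) atTop
      (𝓝 (Real.exp (-((∑ k ∈ Finset.range q, p k * ((k : ℝ) - 1) ^ 2) / 2) * s ^ 2) : ℝ)) := by
  have hg : Tendsto (fun n : ℕ => (n : ℂ) * (centeredChar p q (s / √n) - 1)) atTop
      (𝓝 ((-((∑ k ∈ Finset.range q, p k * ((k : ℝ) - 1) ^ 2) / 2) * s ^ 2 : ℝ) : ℂ)) := by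
    have h := tendsto_finsetSum (Finset.range q) fun k _ =>
      (tendsto_nat_mul_exp_sub (((k : ℝ) - 1) * s)).const_mul (p k : ℂ)
    have hlim : ((-((∑ k ∈ Finset.range q, p k * ((k : ℝ) - 1) ^ 2) / 2) * s ^ 2 : ℝ) : ℂ) =
        ∑ k ∈ Finset.range q, (p k : ℂ) * (-(((k : ℝ) - 1) * s) ^ 2 / 2 : ℝ) := by
      rw [neg_mul, div_mul_eq_mul_div, Finset.sum_mul, Finset.sum_div, ← Finset.sum_neg_distrib]
      push_cast
      exact Finset.sum_congr rfl fun k _ => by ring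
    rw [hlim]
    refine h.congr fun n => ?_
    have h1 : (1 : ℂ) = ∑ k ∈ Finset.range q, (p k : ℂ) := by exact_mod_cast hsum.symm
    have h2 : (0 : ℂ) = ∑ k ∈ Finset.range q, (p k : ℂ) * ((k : ℝ) - 1 : ℝ) := by
      exact_mod_cast hmean.symm
    have h3 : centeredChar p q (s / √n) - 1 = centeredChar p q (s / √n) -
        ∑ k ∈ Finset.range q, (p k : ℂ) -
        (∑ k ∈ Finset.range q, (p k : ℂ) * ((k : ℝ) - 1 : ℝ)) * ((s / √n : ℝ) * Complex.I) := by
      rw [← h1, ← h2]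
      ring
    rw [h3, centeredChar, Finset.sum_mul, ← Finset.sum_sub_distrib, ← Finset.sum_sub_distrib,
      Finset.mul_sum]
    refine Finset.sum_congr rfl fun k _ => ?_
    rw [mul_div_assoc, ← Complex.ofReal_mul]
    push_cast
    ring
  have := Complex.tendsto_one_add_pow_exp_of_tendsto hg
  rw [← Complex.ofReal_exp] at this
  refine this.congr fun n => ?_
  rw [add_sub_cancel]

lemma sqrt_mul_integral_comp_div (g : ℝ → ℂ) (n : ℕ) (hn : n ≠ 0) :
    (√(n : ℝ) : ℂ) * ∫ t in (-Real.pi)..Real.pi, g t =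
      ∫ s, (Set.Ioc (-Real.pi * √n) (Real.pi * √n)).indicator (fun s => g (s / √n)) s := by
  have hs : 0 < √(n : ℝ) := Real.sqrt_pos.2 (by exact_mod_cast Nat.pos_of_ne_zero hn)
  rw [integral_indicator measurableSet_Ioc, ← intervalIntegral.integral_of_le
    (by nlinarith [Real.pi_pos]), intervalIntegral.integral_comp_div _ hs.ne',
    mul_div_cancel_right₀ _ hs.ne', mul_div_cancel_right₀ _ hs.ne', Complex.real_smul]

/-- A local central limit theorem at the mean, in polynomial form. -/
theorem tendsto_sqrt_mul_coeff_pow {p : ℕ → ℝ} {q : ℕ} (hq : 2 ≤ q) (hp : ∀ k, 0 ≤ p k)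
    (h0 : 0 < p 0) (h1 : 0 < p 1) (hsum : ∑ k ∈ Finset.range q, p k = 1)
    (hmean : ∑ k ∈ Finset.range q, p k * ((k : ℝ) - 1) = 0) :
    Tendsto (fun n : ℕ => √(n : ℝ) *
      ((∑ k ∈ Finset.range q, Polynomial.C (p k) * Polynomial.X ^ k) ^ n).coeff n) atTop
      (𝓝 (√(2 * Real.pi / ∑ k ∈ Finset.range q, p k * ((k : ℝ) - 1) ^ 2) / (2 * Real.pi))) := by
  obtain ⟨c, hc, hbound⟩ := exists_norm_centeredChar_le hq hp h0 h1 hsum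
  set V : ℝ := ∑ k ∈ Finset.range q, p k * ((k : ℝ) - 1) ^ 2
  have hpi := Real.pi_pos
  have hlim : Tendsto (fun n : ℕ => ∫ s, (Set.Ioc (-Real.pi * √n) (Real.pi * √n)).indicator
      (fun s => centeredChar p q (s / √n) ^ n) s) atTop
      (𝓝 (∫ s : ℝ, ((Real.exp (-(V / 2) * s ^ 2) : ℝ) : ℂ))) := by
    refine tendsto_integral_of_dominated_convergence (fun s => Real.exp (-c * s ^ 2)) ?_
      (integrable_exp_neg_mul_sq hc) ?_ ?_
    · intro n
      refine AEStronglyMeasurable.indicator ?_ measurableSet_Ioc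
      have := continuous_centeredChar p q
      exact Continuous.aestronglyMeasurable (by fun_prop)
    · intro n
      refine ae_of_all _ fun s => ?_
      by_cases hs : s ∈ Set.Ioc (-Real.pi * √(n : ℝ)) (Real.pi * √n)
      · rw [Set.indicator_of_mem hs, norm_pow]
        -- At n = 0 the interval is empty.
        have hn : 0 < √(n : ℝ) := by
          by_contra hn
          have : √(n : ℝ) = 0 := le_antisymm (not_lt.1 hn) (Real.sqrt_nonneg _)
          rw [this] at hs
          simp at hs
        have hb := hbound (s / √n) (by
          rw [abs_div, abs_of_pos hn, div_le_iff₀ hn, abs_le]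
          exact ⟨by linarith [hs.1], hs.2⟩)
        refine (pow_le_pow_left₀ (norm_nonneg _) hb n).trans_eq ?_
        rw [← Real.exp_nat_mul, div_pow, Real.sq_sqrt (Nat.cast_nonneg n)]
        have : (n : ℝ) ≠ 0 := (Real.sqrt_pos.1 hn).ne'
        congr 1
        field_simp
      · rw [Set.indicator_of_notMem hs, norm_zero]
        positivity
    · refine ae_of_all _ fun s => ?_
      refine (tendsto_centeredChar_pow hsum hmean s).congr' ?_
      have hev : ∀ᶠ n : ℕ in atTop, |s| + 1 ≤ Real.pi * √n :=
        ((Real.tendsto_sqrt_atTop.comp tendsto_natCast_atTop_atTop).const_mul_atTop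
          hpi).eventually_ge_atTop _
      filter_upwards [hev] with n hn
      rw [Set.indicator_of_mem]
      exact ⟨by linarith [neg_abs_le s], by linarith [le_abs_self s]⟩
  rw [integral_complex_ofReal, integral_gaussian] at hlim
  have hre := (Complex.continuous_re.tendsto _).comp hlim
  rw [Complex.ofReal_re] at hre
  have := hre.div_const (2 * Real.pi)
  rw [show Real.pi / (V / 2) = 2 * Real.pi / V by field_simp] at this
  refine this.congr' ?_
  filter_upwards [eventually_ne_atTop 0] with n hn
  rw [Function.comp_apply, ← sqrt_mul_integral_comp_div (fun t => centeredChar p q t ^ n) n hn,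
    integral_centeredChar_pow, show (2 * Real.pi : ℂ) = ((2 * Real.pi : ℝ) : ℂ) by push_cast; rfl, ← Complex.ofReal_mul,
    ← Complex.ofReal_mul, Complex.ofReal_re]
  field_simp

/-! ### Moments of the tilted law -/

lemma sum_pow_mul (r : ℝ) (q : ℕ) :
    (∑ k ∈ Finset.range q, r ^ k) * (1 - r) = 1 - r ^ q := by
  linear_combination -geom_sum_mul r q

lemma sum_nat_mul_pow_mul (r : ℝ) (q : ℕ) :
    (∑ k ∈ Finset.range q, (k : ℝ) * r ^ k) * (1 - r) ^ 2 =
      r - q * r ^ q + (q - 1) * r ^ (q + 1) := by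
  induction q with
  | zero => simp
  | succ q ih =>
    rw [Finset.sum_range_succ, add_mul, ih]
    push_cast
    ring

lemma sum_nat_sq_mul_pow_mul (r : ℝ) (q : ℕ) :
    (∑ k ∈ Finset.range q, (k : ℝ) ^ 2 * r ^ k) * (1 - r) ^ 3 =
      r * (1 + r) - r ^ q * (q ^ 2 - (2 * q ^ 2 - 2 * q - 1) * r + (q - 1) ^ 2 * r ^ 2) := by
  induction q with
  | zero => simp; ring
  | succ q ih =>
    rw [Finset.sum_range_succ, add_mul, ih]
    push_cast
    ring

lemma sum_nat_mul_pow_eq {q : ℕ} {r : ℝ} (hr1 : r ≠ 1)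
    (h : ((q : ℝ) - 2) * r ^ (q + 1) - ((q : ℝ) - 1) * r ^ q + 2 * r - 1 = 0) :
    ∑ k ∈ Finset.range q, (k : ℝ) * r ^ k = ∑ k ∈ Finset.range q, r ^ k := by
  have h1 : (1 - r) ^ 2 ≠ 0 := pow_ne_zero _ (sub_ne_zero.2 hr1.symm)
  refine mul_right_cancel₀ h1 ?_
  rw [sum_nat_mul_pow_mul]
  linear_combination h - (1 - r) * sum_pow_mul r q

lemma variance_eq {q : ℕ} {r : ℝ} (hq : q ≠ 0) (hr : 0 ≤ r) (hr1 : r < 1)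
    (h : ((q : ℝ) - 2) * r ^ (q + 1) - ((q : ℝ) - 1) * r ^ q + 2 * r - 1 = 0) :
    ∑ k ∈ Finset.range q, r ^ k / (∑ j ∈ Finset.range q, r ^ j) * ((k : ℝ) - 1) ^ 2 =
      r / (1 - r) ^ 2 - (q : ℝ) ^ 2 * r ^ q / (1 - r ^ q) ^ 2 := by
  have h1 : 1 - r ≠ 0 := by linarith
  have hw : 1 - r ^ q ≠ 0 := (sub_pos.2 (pow_lt_one₀ hr hr1 hq)).ne'
  have hmean := sum_nat_mul_pow_eq hr1.ne h
  have e0 : ∑ k ∈ Finset.range q, r ^ k = (1 - r ^ q) / (1 - r) := by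
    rw [eq_div_iff h1, sum_pow_mul]
  have e1 : ∑ k ∈ Finset.range q, (k : ℝ) * r ^ k =
      (r - q * r ^ q + (q - 1) * r ^ (q + 1)) / (1 - r) ^ 2 := by
    rw [eq_div_iff (pow_ne_zero _ h1), sum_nat_mul_pow_mul]
  have e2 : ∑ k ∈ Finset.range q, (k : ℝ) ^ 2 * r ^ k =
      (r * (1 + r) - r ^ q * (q ^ 2 - (2 * q ^ 2 - 2 * q - 1) * r + (q - 1) ^ 2 * r ^ 2)) /
        (1 - r) ^ 3 := by
    rw [eq_div_iff (pow_ne_zero _ h1), sum_nat_sq_mul_pow_mul]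
  have hf : ∑ k ∈ Finset.range q, r ^ k ≠ 0 := by
    rw [e0]
    exact div_ne_zero hw h1
  -- The squared mean is kept in place of 1: second moment minus squared mean has the stated closed
  -- form for every such r, without the saddle equation.
  have hV : ∑ k ∈ Finset.range q, r ^ k / (∑ j ∈ Finset.range q, r ^ j) * ((k : ℝ) - 1) ^ 2 =
      (∑ k ∈ Finset.range q, (k : ℝ) ^ 2 * r ^ k) / (∑ j ∈ Finset.range q, r ^ j) -
      ((∑ k ∈ Finset.range q, (k : ℝ) * r ^ k) / (∑ j ∈ Finset.range q, r ^ j)) ^ 2 := by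
    have : ∑ k ∈ Finset.range q, r ^ k / (∑ j ∈ Finset.range q, r ^ j) * ((k : ℝ) - 1) ^ 2 =
        (∑ k ∈ Finset.range q, (k : ℝ) ^ 2 * r ^ k -
          2 * ∑ k ∈ Finset.range q, (k : ℝ) * r ^ k + ∑ k ∈ Finset.range q, r ^ k) /
          (∑ j ∈ Finset.range q, r ^ j) := by
      rw [Finset.mul_sum, ← Finset.sum_sub_distrib, ← Finset.sum_add_distrib, Finset.sum_div]
      exact Finset.sum_congr rfl fun k _ => by ring
    rw [this, hmean]
    field_simp
    ring
  rw [hV, e0, e1, e2, pow_succ r q]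
  generalize r ^ q = w at hw
  field_simp
  ring

/-! ### Return to the polynomial coefficients -/

/-- The tilted polynomial is the original one at `r * X`, divided by f. -/
lemma coeff_scaled_sum_pow (q n : ℕ) (r f : ℝ) :
    ((∑ k ∈ Finset.range q, Polynomial.C (r ^ k / f) * Polynomial.X ^ k) ^ n).coeff n =
      polyCoeff n q n * r ^ n / f ^ n := by
  have h1 : ((∑ k ∈ Finset.range q, (Polynomial.X : Polynomial ℝ) ^ k) ^ n).coeff n =
      polyCoeff n q n := by
    have := Polynomial.coeff_map (Nat.castRingHom ℝ) n
      (p := (∑ i ∈ Finset.range q, (Polynomial.X : Polynomial ℕ) ^ i) ^ n)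
    simpa [polyCoeff, Polynomial.map_sum] using this
  have h2 : (∑ k ∈ Finset.range q, Polynomial.C (r ^ k / f) * Polynomial.X ^ k) ^ n =
      Polynomial.C ((1 / f) ^ n) * (((∑ k ∈ Finset.range q,
        (Polynomial.X : Polynomial ℝ) ^ k) ^ n).comp (Polynomial.C r * Polynomial.X)) := by
    rw [Polynomial.pow_comp, Polynomial.C_pow, ← mul_pow, Polynomial.sum_comp,
      Finset.mul_sum]
    congr 1
    refine Finset.sum_congr rfl fun k _ => ?_
    rw [Polynomial.X_pow_comp, mul_pow, ← mul_assoc, ← Polynomial.C_pow, ← Polynomial.C_mul]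
    congr 2
    ring
  rw [h2, Polynomial.coeff_C_mul, Polynomial.comp_C_mul_X_coeff, h1, one_div, inv_pow]
  ring

theorem tendsto_polyCoeff_div {q : ℕ} (hq : 3 < q) {r : ℝ} (hr : 0 < r) (hr1 : r < 1)
    (h : ((q : ℝ) - 2) * r ^ (q + 1) - ((q : ℝ) - 1) * r ^ q + 2 * r - 1 = 0) :
    Tendsto
      (fun n : ℕ => (polyCoeff n q n : ℝ) /
        (phi q r / Real.sqrt (2 * Real.pi * n) * ((1 - r ^ q) / (r - r ^ 2)) ^ n))
      atTop (𝓝 1) := by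
  have h1 : 0 < 1 - r := by linarith
  have hw : 0 < 1 - r ^ q := sub_pos.2 (pow_lt_one₀ hr.le hr1 (by omega))
  have hpi := Real.pi_pos
  obtain ⟨f, hf⟩ : ∃ f, f = ∑ k ∈ Finset.range q, r ^ k := ⟨_, rfl⟩
  have hf' : f = (1 - r ^ q) / (1 - r) := by rw [eq_div_iff h1.ne', hf, sum_pow_mul]
  have hfpos : 0 < f := by rw [hf']; positivity
  have hsum : ∑ k ∈ Finset.range q, r ^ k / f = 1 := by
    rw [← Finset.sum_div, ← hf, div_self hfpos.ne']
  have hmean : ∑ k ∈ Finset.range q, r ^ k / f * ((k : ℝ) - 1) = 0 := by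
    have := sum_nat_mul_pow_eq hr1.ne h
    have e : ∑ k ∈ Finset.range q, r ^ k / f * ((k : ℝ) - 1) =
        (∑ k ∈ Finset.range q, (k : ℝ) * r ^ k - ∑ k ∈ Finset.range q, r ^ k) / f := by
      rw [← Finset.sum_sub_distrib, Finset.sum_div]
      exact Finset.sum_congr rfl fun k _ => by ring
    rw [e, this, sub_self, zero_div]
  have hlim := tendsto_sqrt_mul_coeff_pow (p := fun k => r ^ k / f) (q := q) (by omega)
    (fun k => by positivity) (by positivity) (by positivity) hsum hmean
  have hV := variance_eq (by omega) hr.le hr1 h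
  rw [← hf] at hV
  have hVpos : 0 < ∑ k ∈ Finset.range q, r ^ k / f * ((k : ℝ) - 1) ^ 2 := by
    refine Finset.sum_pos' (fun k _ => by positivity) ⟨0, Finset.mem_range.2 (by omega), ?_⟩
    norm_num
    positivity
  simp only [hV] at hlim
  rw [hV] at hVpos
  have hphi : phi q r =
      (√(r / (1 - r) ^ 2 - (q : ℝ) ^ 2 * r ^ q / (1 - r ^ q) ^ 2))⁻¹ := by
    rw [phi, Real.rpow_neg hVpos.le, Real.sqrt_eq_rpow]
  rw [hphi]
  generalize r / (1 - r) ^ 2 - (q : ℝ) ^ 2 * r ^ q / (1 - r ^ q) ^ 2 = V at hlim hVpos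
  have hconst : √(2 * Real.pi / V) / (2 * Real.pi) * (√V * √(2 * Real.pi)) = 1 := by
    rw [Real.sqrt_div' _ hVpos.le]
    have e1 : √(2 * Real.pi) * √(2 * Real.pi) = 2 * Real.pi := Real.mul_self_sqrt (by positivity)
    have e2 : √V ≠ 0 := (Real.sqrt_pos.2 hVpos).ne'
    field_simp
    linear_combination e1
  have hlim' := hlim.mul_const (√V * √(2 * Real.pi))
  rw [hconst] at hlim'
  refine hlim'.congr fun n => ?_
  have hB : (1 - r ^ q) / (r - r ^ 2) = f / r := by
    rw [hf', show r - r ^ 2 = r * (1 - r) by ring]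
    field_simp
  rw [coeff_scaled_sum_pow, hB, Real.sqrt_mul (by positivity) (n : ℝ), div_pow]
  simp only [div_eq_mul_inv, mul_inv, inv_inv]
  ring

theorem theorem3p4 (q : ℕ) (hq : 3 < q) :
    ∃ r : ℝ, r ≠ 1 ∧
      {x : ℝ | 0 < x ∧
        ((q : ℝ) - 2) * x ^ (q + 1) - ((q : ℝ) - 1) * x ^ q + 2 * x - 1 = 0} = {1, r} ∧
      |r - 1 / 2 - (q : ℝ) / 2 ^ (q + 2)| ≤ (q : ℝ) ^ 3 / 2 ^ (2 * q) ∧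
      Tendsto
        (fun n : ℕ => (polyCoeff n q n : ℝ) /
          (phi q r / Real.sqrt (2 * Real.pi * n) * ((1 - r ^ q) / (r - r ^ 2)) ^ n))
        atTop (𝓝 1) := by
  have hm : 3 ≤ q - 1 := by omega
  obtain ⟨r, hr, hr1, hS⟩ := exists_saddle hm
  have hr0 : 0 < r := by linarith
  have hiff : ∀ x : ℝ, 0 < x → (((q : ℝ) - 2) * x ^ (q + 1) - ((q : ℝ) - 1) * x ^ q + 2 * x - 1 = 0
      ↔ x = 1 ∨ x = r) := by
    intro x hx
    rw [← saddle_eq_zero_iff hm hr0 hS hx, show q - 1 + 2 = q + 1 by omega,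
      show q - 1 + 1 = q by omega, Nat.cast_sub (by omega), Nat.cast_one,
      show (q : ℝ) - 1 - 1 = q - 2 by ring]
  refine ⟨r, hr1.ne, ?_, abs_saddle_sub_le hq hr hr1 hS,
    tendsto_polyCoeff_div hq hr0 hr1 ((hiff r hr0).2 (.inr rfl))⟩
  ext x
  simp only [Set.mem_ofPred_eq, Set.mem_insert_iff, Set.mem_singleton_iff]
  constructor
  · rintro ⟨hx, hx0⟩
    exact (hiff x hx).1 hx0
  · intro hx
    have hx0 : 0 < x := by rcases hx with rfl | rfl <;> linarith
    exact ⟨hx0, (hiff x hx0).2 hx⟩
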